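/- Let $k$ be any field and $q\in k^*$. Consider the following five types of unital associative $k$-algebras, each the quotient of the free algebra $k\langle x,o\rangle$ by the two-sided ideal generated by one relation, where $o$ is the symbol of a linear operator on $k[x]$: 1. (differential operator $f\mapsto f'$) the first Weyl algebra $k[x]\langle \partial : \partial x = x\partial + 1\rangle$; 2. (shift operator $f(x)\mapsto f(x+1)$) the first shift algebra $k[x]\langle s : s x = x s + s\rangle$; 3. ($q$-shift operator $f(x)\mapsto f(qx)$) the first $q$-shift algebra $k[x]\langle s_q : s_q x = q x s_q\rangle$; 4. ($q$-differential operator $f\mapsto \frac{f(qx)-f(x)}{(q-1)x}$) the first $q$-Weyl algebra $k[x]\langle \partial_q : \partial_q x = q x\partial_q + 1\rangle$; 5. (integration operator $f\mapsto \int_0^x f(t)\,dt$) the algebra $k[x]\langle I : I x = x I - I^2\rangle$. A domain $A$ (not necessarily commutative) is a *finite factorization domain* (FFD) if every nonzero non-unit of $A$ has at least one factorization into irreducible elements and has only finitely many such factorizations up to multiplication of the irreducible factors by central units of $A$. Then: (a) Whenever the formula for the operator makes sense on $k[x]$ (that is, $q\neq 1$ in type 4 and $\operatorname{char} k=0$ in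 type 5), the corresponding algebra acts on $k[x]$ by $k$-linear endomorphisms, with $x$ acting as multiplication by $x$ and the second generator acting as the operator. (b) Each of the algebras 1–5 is a finite factorization domain, for every field $k$ and every $q\in k^*$. (c) For every $n\ge 0$, every tensor product $A_1\otimes_k\cdots\otimes_k A_n$ of algebras $A_i$ from this list (possibly of different types, and with possibly different parameters $q$) is a finite factorization domain; for $n=0$ the tensor product is $k$. -/

import Mathlib

open Polynomial
open scoped TensorProduct

/-! ### Finite factorization domains -/

/-- `l` is an (ordered) factorization of `a` into irreducible elements. -/
def IsIrredFactorization {A : Type*} [Ring A] (a : A) (l : List A) : Prop :=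
  (∀ p ∈ l, Irreducible p) ∧ l.prod = a

/-- Two (ordered) factorizations are the same up to multiplication of the factors by central
units: they have the same length and corresponding factors differ by a central unit. -/
def SameUpToCentralUnits {A : Type*} [Ring A] (l m : List A) : Prop :=
  List.Forall₂ (fun p p' : A => ∃ c : Aˣ, (c : A) ∈ Subring.center A ∧ p' = c * p) l m

/-- Finite factorization domain: a (not necessarily commutative) domain in which every nonzero
non-unit has a factorization into irreducible elements, and only finitely many of them up to
multiplication of the factors by central units (a finite set of factorizations represents all). -/
structure IsFiniteFactorizationDomain (A : Type*) [Ring A] : Prop where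
  isDomain : IsDomain A
  exists_factorization : ∀ a : A, a ≠ 0 → ¬ IsUnit a → ∃ l : List A, IsIrredFactorization a l
  finite_factorizations : ∀ a : A, a ≠ 0 → ¬ IsUnit a →
    ∃ S : Set (List A), S.Finite ∧ (∀ m ∈ S, IsIrredFactorization a m) ∧
      ∀ l : List A, IsIrredFactorization a l → ∃ m ∈ S, SameUpToCentralUnits l m

/-! ### The operators and their algebras -/

/-- The five types of operators; the two `q`-types carry a unit `q` of the field. -/
inductive OpType (k : Type*) [Field k]
  | differential
  | shift
  | qShift (q : kˣ)
  | qDifferential (q : kˣ)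
  | integration

/-- The two generators: the variable `x` and the operator symbol `o`. -/
inductive OpGen
  | x
  | o

/-- The right-hand side of the defining relation `o x = …`, in the free algebra `k⟨x, o⟩`. -/
def OpType.relRHS {k : Type*} [Field k] :
    OpType k → FreeAlgebra k OpGen → FreeAlgebra k OpGen → FreeAlgebra k OpGen
  | .differential, x, o => x * o + 1
  | .shift, x, o => x * o + o
  | .qShift q, x, o => (q : k) • (x * o)
  | .qDifferential q, x, o => (q : k) • (x * o) + 1
  | .integration, x, o => x * o - o ^ 2

/-- The single defining relation `o x = …` of the operator algebra. -/
def OpType.Rel {k : Type*} [Field k] (t : OpType k) (a b : FreeAlgebra k OpGen) : Prop :=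
  a = FreeAlgebra.ι k OpGen.o * FreeAlgebra.ι k OpGen.x ∧
    b = t.relRHS (FreeAlgebra.ι k OpGen.x) (FreeAlgebra.ι k OpGen.o)

/-- The operator algebra `k[x]⟨o : o x = …⟩`: the quotient of the free algebra `k⟨x, o⟩` by the
two-sided ideal generated by the defining relation. -/
abbrev OpAlg {k : Type*} [Field k] (t : OpType k) : Type _ := RingQuot t.Rel

/-- The classes of `x` and `o` in the operator algebra. -/
noncomputable def OpAlg.gen {k : Type*} [Field k] (t : OpType k) (g : OpGen) : OpAlg t :=
  RingQuot.mkAlgHom k t.Rel (FreeAlgebra.ι k g)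

/-- The `q`-differential operator `f ↦ (f(qx) - f(x)) / ((q-1)x)`; for `q = 1` the value is the
junk value `0`. -/
noncomputable def qDerivative {k : Type*} [Field k] (q : k) : k[X] →ₗ[k] k[X] where
  toFun f := C (q - 1)⁻¹ * divX (f.comp (C q * X) - f)
  map_add' f g := by
    rw [← mul_add, ← divX_add, add_comp]; congr 2; ring
  map_smul' c f := by
    simp only [smul_eq_C_mul, mul_comp, C_comp, RingHom.id_apply, ← mul_sub, divX_C_mul]; ring

theorem qDerivative_spec {k : Type*} [Field k] (q : k) (hq : q ≠ 1) (f : k[X]) :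
    C (q - 1) * X * qDerivative q f = f.comp (C q * X) - f := by
  have h := divX_mul_X_add (f.comp (C q * X) - f)
  have h0 : (f.comp (C q * X) - f).coeff 0 = 0 := by
    simp [coeff_zero_eq_eval_zero, eval_comp]
  rw [h0, C_0, add_zero] at h
  have h1 : (C (q - 1) : k[X]) * C (q - 1)⁻¹ = 1 := by
    rw [← C_mul, mul_inv_cancel₀ (sub_ne_zero.2 hq), C_1]
  change C (q - 1) * X * (C (q - 1)⁻¹ * divX (f.comp (C q * X) - f)) = _
  calc _ = (C (q - 1) * C (q - 1)⁻¹) * (divX (f.comp (C q * X) - f) * X) := by ring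
    _ = _ := by rw [h1, h, one_mul]

/-- The integration operator `f ↦ ∫₀ˣ f(t) dt`, that is `xⁿ ↦ xⁿ⁺¹ / (n + 1)`; meaningful in
characteristic zero. -/
noncomputable def integralFromZero (k : Type*) [Field k] : k[X] →ₗ[k] k[X] :=
  Polynomial.lsum fun n => ((n : k) + 1)⁻¹ • Polynomial.monomial (n + 1)

theorem integralFromZero_spec {k : Type*} [Field k] [CharZero k] (f : k[X]) :
    derivative (integralFromZero k f) = f ∧ (integralFromZero k f).eval 0 = 0 := by
  have hm : ∀ (n : ℕ) (a : k), integralFromZero k (monomial n a) =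
      ((n : k) + 1)⁻¹ • monomial (n + 1) a := fun n a => by
    simp [integralFromZero, lsum_apply, sum_monomial_index]
  induction f using Polynomial.induction_on' with
  | add p q hp hq => simp [hp.1, hp.2, hq.1, hq.2]
  | monomial n a =>
    have : (n : k) + 1 ≠ 0 := Nat.cast_add_one_ne_zero n
    rw [hm]
    constructor
    · rw [derivative_smul, derivative_monomial, smul_monomial, smul_eq_mul]
      congr 1; push_cast; field_simp
    · simp

/-- The linear operator on `k[x]` that each type stands for. -/
noncomputable def OpType.operator {k : Type*} [Field k] : OpType k → (k[X] →ₗ[k] k[X])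
  | .differential => derivative
  | .shift => (aeval (X + 1 : k[X])).toLinearMap
  | .qShift q => (aeval (C (q : k) * X : k[X])).toLinearMap
  | .qDifferential q => qDerivative (q : k)
  | .integration => integralFromZero k

/-- The condition under which the formula for the operator makes sense on `k[x]`. -/
def OpType.IsMeaningful {k : Type*} [Field k] : OpType k → Prop
  | .qDifferential q => (q : k) ≠ 1
  | .integration => CharZero k
  | _ => True

/-! Each algebra in the list, after swapping the generators for integration, has the form `y z = (a
z + b) y + c₀ + c₂ z²` with `a ≠ 0`, and the monomials `zⁱ yʲ` are a basis. In degree-lexicographic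
order the product of two monomials leads with the sum of the exponents, with a power of `a` as
coefficient. `LeadingBasis` abstracts this property, which passes to tensor products.

Leading terms then multiply, even after extending scalars to any field. So the algebra is a domain
whose units are the nonzero scalars, and descent on the leading key gives factorizations.

The heart is `finite_normalized_left_factors`. Factors of `a` have coordinates in a finite set of
indices. If infinitely many normalized left factors existed, the ultrapower of `k` along a
nonprincipal ultrafilter on them would carry a generic factorization of `a`. A Gauss lemma
(`mem_valuationSubring_of_sum_struct_mem`) puts the coefficients of its left factor in every
valuation ring containing `k`, so they are integral over `k`. A monic polynomial has finitely many
roots in `k`, so such elements of the ultrapower are constants. The generic factor is thus a single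
element, contradicting nonprincipality. Splitting off the first factor and inducting on the key
(`finite_map_normalize_factorizations`) bounds all factorizations. -/

/-! ### Algebras with a basis whose products have leading terms -/

/-- A basis of a `k`-algebra, indexed by a monoid which embeds into an ordered monoid by `key`,
such that the product of two basis elements has a nonzero coefficient at the sum of the indices,
and otherwise only terms of smaller key. -/
structure LeadingBasis (k A M Γ : Type*) [Field k] [Ring A] [Algebra k A] [AddCommMonoid M]
    [AddCommMonoid Γ] [LinearOrder Γ] where
  basis : Module.Basis M k A
  key : M →+ Γ
  key_injective : Function.Injective key
  key_nonneg : ∀ m, 0 ≤ key m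
  finite_key_le : ∀ g, {m | key m ≤ g}.Finite
  basis_zero : basis 0 = 1
  key_le_of_repr_ne_zero : ∀ m n r, basis.repr (basis m * basis n) r ≠ 0 → key r ≤ key (m + n)
  repr_add_ne_zero : ∀ m n, basis.repr (basis m * basis n) (m + n) ≠ 0

theorem Finset.exists_max_key_of_ne_zero {M Γ F : Type*} [LinearOrder Γ] [Zero F]
    (key : M → Γ) {D : Finset M} {f : M → F} (h : ∃ m ∈ D, f m ≠ 0) :
    ∃ m ∈ D, f m ≠ 0 ∧ ∀ n ∈ D, f n ≠ 0 → key n ≤ key m := by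
  classical
  obtain ⟨m, hm, hf⟩ := h
  obtain ⟨m₀, h₀, hmax⟩ := (D.filter (f · ≠ 0)).exists_max_image key ⟨m, by simp [hm, hf]⟩
  rw [Finset.mem_filter] at h₀
  exact ⟨m₀, h₀.1, h₀.2, fun n hn hfn => hmax n (by simp [hn, hfn])⟩

/-! ### Products in coordinates and Gauss's lemma. -/

namespace LeadingBasis

variable {k A M Γ : Type*} [Field k] [Ring A] [Algebra k A] [AddCommMonoid M]
    [AddCommMonoid Γ] [LinearOrder Γ] (B : LeadingBasis k A M Γ)

/-- The structure constants of the multiplication. -/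
noncomputable def struct (m n r : M) : k := B.basis.repr (B.basis m * B.basis n) r

theorem repr_mul_apply (a b : A) {D E : Finset M} (hD : (B.basis.repr a).support ⊆ D)
    (hE : (B.basis.repr b).support ⊆ E) (r : M) :
    B.basis.repr (a * b) r =
      ∑ m ∈ D, ∑ n ∈ E, B.basis.repr a m * B.basis.repr b n * B.struct m n r := by
  have expand : ∀ (c : A) {D : Finset M}, (B.basis.repr c).support ⊆ D →
      c = ∑ m ∈ D, B.basis.repr c m • B.basis m := fun c D hD => by
    conv_lhs => rw [← B.basis.linearCombination_repr c, Finsupp.linearCombination_apply]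
    exact Finsupp.sum_of_support_subset _ hD _ (by simp)
  conv_lhs => rw [expand a hD, expand b hE]
  simp only [Finset.sum_mul, Finset.mul_sum, map_sum, Finsupp.finsetSum_apply, smul_mul_assoc,
    mul_smul_comm, map_smul, Finsupp.smul_apply, smul_eq_mul, struct, mul_assoc]
  rw [Finset.sum_comm]
  simp only [mul_left_comm]

variable [IsOrderedCancelAddMonoid Γ]

/-- Any other contributing pair has a strictly smaller key sum, by cancellation in `Γ`, so it cannot
reach the index `m + n`. The coefficients lie in an arbitrary `F` so that the result serves both `k`
and residue fields. -/
theorem sum_struct_add {F : Type*} [CommRing F] (φ : k →+* F) {D E : Finset M} {f g : M → F}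
    {m n : M} (hm : m ∈ D) (hn : n ∈ E) (hfm : ∀ i ∈ D, f i ≠ 0 → B.key i ≤ B.key m)
    (hgn : ∀ j ∈ E, g j ≠ 0 → B.key j ≤ B.key n) :
    ∑ i ∈ D, ∑ j ∈ E, f i * g j * φ (B.struct i j (m + n)) =
      f m * g n * φ (B.struct m n (m + n)) := by
  have key : ∀ i ∈ D, ∀ j ∈ E, f i * g j * φ (B.struct i j (m + n)) ≠ 0 → i = m ∧ j = n := by
    intro i hi j hj h
    have h1 : f i ≠ 0 := by rintro h0; simp [h0] at h
    have h2 : g j ≠ 0 := by rintro h0; simp [h0] at h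
    have h3 : B.struct i j (m + n) ≠ 0 := by rintro h0; simp [h0] at h
    have h4 := B.key_le_of_repr_ne_zero _ _ _ h3
    rw [map_add, map_add] at h4
    have h5 := hfm i hi h1
    have h6 := hgn j hj h2
    have h7 : B.key i = B.key m := le_antisymm h5 (le_of_not_gt fun hlt =>
      absurd h4 (not_le_of_gt (add_lt_add_of_lt_of_le hlt h6)))
    have h8 : B.key j = B.key n := le_antisymm h6 (le_of_not_gt fun hlt =>
      absurd h4 (not_le_of_gt (add_lt_add_of_le_of_lt h5 hlt)))
    exact ⟨B.key_injective h7, B.key_injective h8⟩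
  rw [Finset.sum_eq_single_of_mem m hm, Finset.sum_eq_single_of_mem n hn]
  · intro j hj hjn
    by_contra h
    exact hjn (key m hm j hj h).2
  · intro i hi him
    refine Finset.sum_eq_zero fun j hj => ?_
    by_contra h
    exact him (key i hi j hj h).1

/-- In coordinates, this says that extending scalars along `φ` creates no zero divisors: the leading
structure constants stay nonzero because `φ` is injective. -/
theorem exists_sum_struct_ne_zero {F : Type*} [Field F] (φ : k →+* F) {D E : Finset M}
    {f g : M → F} (hf : ∃ m ∈ D, f m ≠ 0) (hg : ∃ m ∈ E, g m ≠ 0) :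
    ∃ r, ∑ i ∈ D, ∑ j ∈ E, f i * g j * φ (B.struct i j r) ≠ 0 := by
  obtain ⟨m, hm, hfm, hm'⟩ := Finset.exists_max_key_of_ne_zero B.key hf
  obtain ⟨n, hn, hgn, hn'⟩ := Finset.exists_max_key_of_ne_zero B.key hg
  refine ⟨m + n, ?_⟩
  rw [B.sum_struct_add φ hm hn hm' hn']
  exact mul_ne_zero (mul_ne_zero hfm hgn) ((map_ne_zero φ).2 (B.repr_add_ne_zero m n))

/-- A form of Gauss's lemma: if a product has coefficients in a valuation subring containing
`k`, then so do its factors, once each is normalized at one coefficient. -/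
theorem mem_valuationSubring_of_sum_struct_mem {L : Type*} [Field L] (φ : k →+* L)
    (O : ValuationSubring L) (hO : ∀ c, φ c ∈ O) {D : Finset M} {f g : M → L} {m₀ n₀ : M}
    (hm₀ : m₀ ∈ D) (hn₀ : n₀ ∈ D) (hf : f m₀ = 1) {c : k} (hc : c ≠ 0) (hg : g n₀ = φ c)
    (h : ∀ r, ∑ i ∈ D, ∑ j ∈ D, f i * g j * φ (B.struct i j r) ∈ O) :
    ∀ m ∈ D, f m ∈ O := by
  classical
  have hv : ∀ c, c ≠ 0 → O.valuation (φ c) = 1 := fun c hc => by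
    refine le_antisymm ((O.valuation_le_one_iff _).2 (hO c)) ?_
    have h1 := (O.valuation_le_one_iff _).2 (hO c⁻¹)
    rw [map_inv₀, map_inv₀] at h1
    have : O.valuation (φ c) ≠ 0 := by simpa using hc
    exact (inv_le_one₀ (zero_lt_iff.2 this)).1 h1
  -- Dividing by coefficients of maximal valuation makes both families integral with a coefficient
  -- `1`, hence nonzero in the residue field.
  obtain ⟨m, hm, hmax⟩ := D.exists_max_image (fun i => O.valuation (f i)) ⟨m₀, hm₀⟩
  obtain ⟨n, hn, hnax⟩ := D.exists_max_image (fun i => O.valuation (g i)) ⟨m₀, hm₀⟩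
  have hs : 1 ≤ O.valuation (f m) := by simpa [hf] using hmax _ hm₀
  have ht : 1 ≤ O.valuation (g n) := by simpa [hg, hv c hc] using hnax _ hn₀
  have hs0 : f m ≠ 0 := fun h0 => by simp [h0] at hs
  have ht0 : g n ≠ 0 := fun h0 => by simp [h0] at ht
  have hF : ∀ i ∈ D, f i / f m ∈ O := fun i hi => by
    rw [← O.valuation_le_one_iff, map_div₀]
    exact div_le_one_of_le₀ (hmax i hi) zero_le
  have hG : ∀ i ∈ D, g i / g n ∈ O := fun i hi => by
    rw [← O.valuation_le_one_iff, map_div₀]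
    exact div_le_one_of_le₀ (hnax i hi) zero_le
  let F : M → O := fun i => if hi : i ∈ D then ⟨f i / f m, hF i hi⟩ else 0
  let G : M → O := fun i => if hi : i ∈ D then ⟨g i / g n, hG i hi⟩ else 0
  have hFv : ∀ i ∈ D, (F i : L) = f i / f m := fun i hi => by simp [F, hi]
  have hGv : ∀ i ∈ D, (G i : L) = g i / g n := fun i hi => by simp [G, hi]
  have hF1 : F m = 1 := Subtype.ext (by rw [hFv m hm, div_self hs0]; rfl)
  have hG1 : G n = 1 := Subtype.ext (by rw [hGv n hn, div_self ht0]; rfl)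
  let ψ : k →+* O := φ.codRestrict O.toSubring hO
  obtain ⟨r, hr⟩ := B.exists_sum_struct_ne_zero ((IsLocalRing.residue O).comp ψ)
    (f := fun i => IsLocalRing.residue O (F i)) (g := fun i => IsLocalRing.residue O (G i))
    (D := D) (E := D) ⟨m, hm, by simp [hF1]⟩ ⟨n, hn, by simp [hG1]⟩
  have hr' : IsLocalRing.residue O (∑ i ∈ D, ∑ j ∈ D, F i * G j * ψ (B.struct i j r)) ≠ 0 := by
    simpa only [map_sum, map_mul, RingHom.comp_apply] using hr
  rw [IsLocalRing.residue_ne_zero_iff_isUnit, O.valuation_eq_one_iff] at hr'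
  have hcoe : ((∑ i ∈ D, ∑ j ∈ D, F i * G j * ψ (B.struct i j r) : O) : L) * (f m * g n) =
      ∑ i ∈ D, ∑ j ∈ D, f i * g j * φ (B.struct i j r) := by
    rw [← O.coe_subtype]
    simp only [map_sum, map_mul, Finset.sum_mul]
    refine Finset.sum_congr rfl fun i hi => Finset.sum_congr rfl fun j hj => ?_
    have : O.subtype (ψ (B.struct i j r)) = φ (B.struct i j r) := rfl
    rw [O.coe_subtype, hFv i hi, hGv j hj, ← O.coe_subtype, this]
    field_simp
  -- Some coefficient of the product has valuation exactly that of `f m * g n`. It is at most `1`,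
  -- while both factors are at least `1` by the normalization at `m₀` and `n₀`.
  have hle := (O.valuation_le_one_iff _).2 (h r)
  rw [← hcoe, map_mul, hr', one_mul, map_mul] at hle
  have hs1 : O.valuation (f m) ≤ 1 := (le_mul_of_one_le_right' ht).trans hle
  exact fun i hi => (O.valuation_le_one_iff _).1 ((hmax i hi).trans hs1)

end LeadingBasis

/-! ### Integrality over `k`, by valuation rings and in ultrapowers. -/

/-- The integral closure of `k` in `L` is integrally closed in `L`, so an element outside it is
excluded by some valuation ring containing it. -/
theorem isIntegralElem_of_forall_valuationSubring {k L : Type*} [Field k] [Field L]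
    (φ : k →+* L) {y : L} (h : ∀ O : ValuationSubring L, (∀ c, φ c ∈ O) → y ∈ O) :
    φ.IsIntegralElem y := by
  let := φ.toAlgebra
  by_contra hy
  have hy' : y ∉ (integralClosure k L).toSubring := hy
  have : IsIntegrallyClosedIn (integralClosure k L).toSubring L :=
    inferInstanceAs (IsIntegrallyClosedIn (integralClosure k L) L)
  obtain ⟨V, hV, hyV⟩ := Subring.exists_le_valuationSubring_of_isIntegrallyClosedIn hy'
  exact hyV (h V fun c => hV ((integralClosure k L).algebraMap_mem c))

/-- A monic equation for the germ holds at almost every coordinate, so `h` takes values there in a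
finite set of roots; an ultrafilter selects one of them. -/
theorem Filter.Germ.exists_eventually_eq_of_isIntegralElem {k X : Type*} [Field k]
    (U : Ultrafilter X) (h : X → k)
    (hint : ((Filter.Germ.coeRingHom (U : Filter X)).comp
      (Pi.constRingHom X k)).IsIntegralElem (h : Filter.Germ (U : Filter X) k)) :
    ∃ c, ∀ᶠ x in (U : Filter X), h x = c := by
  obtain ⟨p, hp, hpy⟩ := hint
  have h1 : ∀ᶠ x in (U : Filter X), p.eval (h x) = 0 := by
    have h2 : (Filter.Germ.coeRingHom (U : Filter X)) (p.eval₂ (Pi.constRingHom X k) h) = 0 := by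
      rw [hom_eval₂]; exact hpy
    have h3 : (fun x => p.eval (h x)) = p.eval₂ (Pi.constRingHom X k) h := by
      funext x
      have := hom_eval₂ p (Pi.constRingHom X k) (Pi.evalRingHom (fun _ : X => k) x) h
      rw [← Pi.evalRingHom_apply (fun _ : X => k) x (p.eval₂ _ _), this]
      rfl
    rw [← h3] at h2
    exact Filter.Germ.coe_eq.1 h2
  have h4 : ∀ᶠ x in (U : Filter X), ∃ c ∈ {c | p.IsRoot c}, h x = c := by
    filter_upwards [h1] with x hx using ⟨_, hx, rfl⟩
  have hfin : {c | p.IsRoot c}.Finite := p.finite_setOfPred_isRoot hp.ne_zero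
  obtain ⟨c, -, hc⟩ := (Ultrafilter.eventually_exists_mem_iff hfin).1 h4
  exact ⟨c, hc⟩

/-! ### Finiteness of normalized left factors. -/

namespace LeadingBasis

variable {k A M Γ : Type*} [Field k] [Ring A] [Algebra k A] [AddCommMonoid M]
    [AddCommMonoid Γ] [LinearOrder Γ] [IsOrderedCancelAddMonoid Γ] (B : LeadingBasis k A M Γ)

theorem finite_normalized_left_factors (a : A) {D : Finset M} {m₀ n₀ : M} (hm₀ : m₀ ∈ D)
    (hn₀ : n₀ ∈ D) {c : k} (hc : c ≠ 0) :
    {b : A | (B.basis.repr b).support ⊆ D ∧ B.basis.repr b m₀ = 1 ∧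
      ∃ d, (B.basis.repr d).support ⊆ D ∧ B.basis.repr d n₀ = c ∧ b * d = a}.Finite := by
  by_contra hinf
  set S := {b : A | (B.basis.repr b).support ⊆ D ∧ B.basis.repr b m₀ = 1 ∧
      ∃ d, (B.basis.repr d).support ⊆ D ∧ B.basis.repr d n₀ = c ∧ b * d = a} with hS
  have : Infinite S := Set.infinite_coe_iff.2 hinf
  let U : Ultrafilter S := Filter.hyperfilter S
  let φ : k →+* Filter.Germ (U : Filter S) k :=
    (Filter.Germ.coeRingHom (U : Filter S)).comp (Pi.constRingHom S k)
  choose d hdD hdc hbd using fun b : S => b.2.2.2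
  -- The germs of the coordinates form a generic factorization of `a` over the ultrapower, to which
  -- Gauss's lemma applies.
  have hconst : ∀ m ∈ D, ∃ c, ∀ᶠ b : S in (U : Filter S), B.basis.repr (b : A) m = c := by
    intro m hm
    refine Filter.Germ.exists_eventually_eq_of_isIntegralElem U _
      (isIntegralElem_of_forall_valuationSubring φ fun O hO => ?_)
    refine B.mem_valuationSubring_of_sum_struct_mem φ O hO
      (f := fun m => ((fun b : S => B.basis.repr (b : A) m : S → k) : Filter.Germ (U : Filter S) k))
      (g := fun m => ((fun b : S => B.basis.repr (d b) m : S → k) : Filter.Germ (U : Filter S) k))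
      hm₀ hn₀ ?_ hc ?_ (fun r => ?_) m hm
    · exact congrArg _ (funext fun b : S => b.2.2.1)
    · exact congrArg _ (funext fun b : S => hdc b)
    · convert hO (B.basis.repr a r) using 1
      let ψ := Filter.Germ.coeRingHom (R := k) (U : Filter S)
      change ∑ i ∈ D, ∑ j ∈ D, ψ (fun b : S => B.basis.repr (b : A) i) *
        ψ (fun b : S => B.basis.repr (d b) j) * ψ (fun _ => B.struct i j r) =
        ψ (fun _ => B.basis.repr a r)
      simp only [← map_mul, ← map_sum]
      congr 1
      funext b
      rw [← hbd b, B.repr_mul_apply _ _ b.2.1 (hdD b)]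
      simp
  choose! v hv using hconst
  have hev : ∀ᶠ b : S in (U : Filter S), ∀ m ∈ D, B.basis.repr (b : A) m = v m :=
    (Filter.eventually_all_finset D).2 hv
  obtain ⟨b, hb⟩ := hev.exists
  have hev' : ∀ᶠ b' : S in (U : Filter S), b' = b := by
    filter_upwards [hev] with b' hb'
    refine Subtype.ext (B.basis.repr.injective (Finsupp.ext fun m => ?_))
    by_cases hm : m ∈ D
    · rw [hb m hm, hb' m hm]
    · rw [Finsupp.notMem_support_iff.1 fun h => hm (b.2.1 h),
        Finsupp.notMem_support_iff.1 fun h => hm (b'.2.1 h)]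
  -- Almost all elements of `S` equal `b`, but the hyperfilter contains no finite set.
  exact Set.Finite.notMem_hyperfilter (Set.finite_singleton b) hev'

end LeadingBasis

/-! ### Leading terms, normalization and units. -/

namespace LeadingBasis

variable {k A M Γ : Type*} [Field k] [Ring A] [Algebra k A] [AddCommMonoid M]
    [AddCommMonoid Γ] [LinearOrder Γ] (B : LeadingBasis k A M Γ)

/-- `m` is the index of the leading term of `a`. -/
def IsLead (a : A) (m : M) : Prop :=
  B.basis.repr a m ≠ 0 ∧ ∀ r, B.basis.repr a r ≠ 0 → B.key r ≤ B.key m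

theorem exists_isLead {a : A} (ha : a ≠ 0) : ∃ m, B.IsLead a m := by
  have h : ∃ m ∈ (B.basis.repr a).support, B.basis.repr a m ≠ 0 := by
    by_contra! h
    exact ha (B.basis.repr.map_eq_zero_iff.1 (Finsupp.ext fun m => by
      by_contra h0
      exact h0 (h m (Finsupp.mem_support_iff.2 h0))))
  obtain ⟨m, -, hm, hmax⟩ := Finset.exists_max_key_of_ne_zero B.key h
  exact ⟨m, hm, fun r hr => hmax r (Finsupp.mem_support_iff.2 hr) hr⟩

variable {B}

theorem IsLead.ne_zero {a : A} {m : M} (h : B.IsLead a m) : a ≠ 0 := by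
  rintro rfl
  exact h.1 (by simp)

theorem IsLead.unique {a : A} {m n : M} (hm : B.IsLead a m) (hn : B.IsLead a n) : m = n :=
  B.key_injective (le_antisymm (hn.2 _ hm.1) (hm.2 _ hn.1))

theorem IsLead.smul {a : A} {m : M} (hm : B.IsLead a m) {c : k} (hc : c ≠ 0) :
    B.IsLead (c • a) m :=
  ⟨by simpa using ⟨hc, hm.1⟩, fun r hr => hm.2 r (by
    simp only [map_smul, Finsupp.smul_apply, smul_eq_mul] at hr
    exact right_ne_zero_of_mul hr)⟩

variable (B) in
theorem isLead_one : B.IsLead 1 0 := by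
  rw [← B.basis_zero]
  refine ⟨by simp, fun r hr => ?_⟩
  rw [B.basis.repr_self] at hr
  have : r = 0 := by
    by_contra h
    exact hr (Finsupp.single_eq_of_ne h)
  rw [this]

theorem IsLead.eq_smul_one {a : A} (h : B.IsLead a 0) : a = B.basis.repr a 0 • (1 : A) := by
  apply B.basis.repr.injective
  rw [map_smul, ← B.basis_zero, B.basis.repr_self, Finsupp.smul_single, smul_eq_mul, mul_one]
  ext r
  by_cases hr : r = 0
  · rw [hr, Finsupp.single_eq_same]
  · rw [Finsupp.single_eq_of_ne hr]
    by_contra h0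
    have := h.2 r h0
    rw [map_zero] at this
    exact hr (B.key_injective (by rw [map_zero]; exact le_antisymm this (B.key_nonneg r)))

theorem isUnit_smul_one {c : k} (hc : c ≠ 0) : IsUnit (c • (1 : A)) := by
  rw [← Algebra.algebraMap_eq_smul_one]
  exact (IsUnit.mk0 c hc).map (algebraMap k A)

variable (B)

/-- The index of the leading term, `0` for the zero element. -/
noncomputable def lead (a : A) : M :=
  open Classical in if h : a ≠ 0 then (B.exists_isLead h).choose else 0

/-- The scalar multiple with leading coefficient `1`. -/
noncomputable def normalize (a : A) : A := (B.basis.repr a (B.lead a))⁻¹ • a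

variable {B}

theorem isLead_lead {a : A} (ha : a ≠ 0) : B.IsLead a (B.lead a) := by
  rw [lead, dif_pos ha]
  exact (B.exists_isLead ha).choose_spec

theorem IsLead.lead_eq {a : A} {m : M} (h : B.IsLead a m) : B.lead a = m :=
  (isLead_lead h.ne_zero).unique h

theorem smul_normalize {a : A} (ha : a ≠ 0) :
    B.basis.repr a (B.lead a) • B.normalize a = a := by
  rw [normalize, smul_smul, mul_inv_cancel₀ (isLead_lead ha).1, one_smul]

theorem exists_smul_eq_of_normalize_eq {a b : A} (ha : a ≠ 0) (hb : b ≠ 0)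
    (h : B.normalize a = B.normalize b) : ∃ c : k, c ≠ 0 ∧ b = c • a := by
  refine ⟨B.basis.repr b (B.lead b) * (B.basis.repr a (B.lead a))⁻¹,
    mul_ne_zero (isLead_lead hb).1 (inv_ne_zero (isLead_lead ha).1), ?_⟩
  rw [mul_smul]
  change b = _ • B.normalize a
  rw [h, smul_normalize hb]

variable (B) in
theorem sameUpToCentralUnits_of_map_normalize_eq {l m : List A} (hl : ∀ p ∈ l, p ≠ 0)
    (hm : ∀ p ∈ m, p ≠ 0) (h : l.map B.normalize = m.map B.normalize) :
    SameUpToCentralUnits l m := by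
  induction l generalizing m with
  | nil =>
    obtain rfl : m = [] := by simpa using h.symm
    exact List.Forall₂.nil
  | cons p l ih =>
    cases m with
    | nil => simp at h
    | cons q m =>
      simp only [List.map_cons, List.cons.injEq] at h
      refine List.Forall₂.cons ?_ (ih (fun r hr => hl r (by simp [hr]))
        (fun r hr => hm r (by simp [hr])) h.2)
      obtain ⟨c, hc, hcq⟩ := exists_smul_eq_of_normalize_eq (hl p (by simp)) (hm q (by simp)) h.1
      refine ⟨((IsUnit.mk0 c hc).map (algebraMap k A)).unit, ?_, ?_⟩
      · exact Subring.mem_center_iff.2 fun g => (Algebra.commutes c g).symm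
      · rw [hcq, Algebra.smul_def]
        rfl

variable [IsOrderedCancelAddMonoid Γ]

theorem IsLead.repr_mul {a b : A} {m n : M} (hm : B.IsLead a m) (hn : B.IsLead b n) :
    B.basis.repr (a * b) (m + n) =
      B.basis.repr a m * B.basis.repr b n * B.struct m n (m + n) := by
  rw [B.repr_mul_apply a b subset_rfl subset_rfl]
  exact B.sum_struct_add (RingHom.id k) (Finsupp.mem_support_iff.2 hm.1)
    (Finsupp.mem_support_iff.2 hn.1) (fun i _ => hm.2 i) (fun i _ => hn.2 i)

theorem IsLead.mul {a b : A} {m n : M} (hm : B.IsLead a m) (hn : B.IsLead b n) :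
    B.IsLead (a * b) (m + n) := by
  refine ⟨?_, fun r hr => ?_⟩
  · rw [hm.repr_mul hn]
    exact mul_ne_zero (mul_ne_zero hm.1 hn.1) (B.repr_add_ne_zero m n)
  · rw [B.repr_mul_apply a b subset_rfl subset_rfl] at hr
    obtain ⟨i, -, hi⟩ := Finset.exists_ne_zero_of_sum_ne_zero hr
    obtain ⟨j, -, hj⟩ := Finset.exists_ne_zero_of_sum_ne_zero hi
    refine (B.key_le_of_repr_ne_zero i j r (right_ne_zero_of_mul hj)).trans ?_
    rw [map_add, map_add]
    exact add_le_add (hm.2 i (left_ne_zero_of_mul (left_ne_zero_of_mul hj)))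
      (hn.2 j (right_ne_zero_of_mul (left_ne_zero_of_mul hj)))

theorem key_le_add_left (m n : M) : B.key m ≤ B.key (m + n) := by
  rw [map_add]
  exact le_add_of_nonneg_right (B.key_nonneg n)

theorem key_le_add_right (m n : M) : B.key n ≤ B.key (m + n) := by
  rw [map_add]
  exact le_add_of_nonneg_left (B.key_nonneg m)

theorem isDomain (B : LeadingBasis k A M Γ) : IsDomain A := by
  have : Nontrivial A := ⟨1, 0, B.isLead_one.ne_zero⟩
  have : NoZeroDivisors A := ⟨fun {a b} h => by
    by_contra! h0
    obtain ⟨m, hm⟩ := B.exists_isLead h0.1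
    obtain ⟨n, hn⟩ := B.exists_isLead h0.2
    exact (hm.mul hn).ne_zero h⟩
  exact NoZeroDivisors.to_isDomain A

/-- The leading indices of a unit and its inverse add up to `0`, and keys are nonnegative.
Conversely, `0` has the least key, so an element led by `0` is a scalar. Thus all units are central.
-/
theorem IsLead.isUnit_iff {a : A} {m : M} (hm : B.IsLead a m) : IsUnit a ↔ m = 0 := by
  constructor
  · rintro ⟨u, rfl⟩
    obtain ⟨n, hn⟩ := B.exists_isLead (a := (↑u⁻¹ : A)) (by
      have := B.isDomain
      exact Units.ne_zero _)
    have h := hm.mul hn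
    rw [Units.mul_inv] at h
    have h0 := h.unique B.isLead_one
    apply B.key_injective
    rw [map_zero]
    refine le_antisymm ?_ (B.key_nonneg m)
    have := key_le_add_left (B := B) m n
    rwa [h0, map_zero] at this
  · rintro rfl
    rw [hm.eq_smul_one]
    exact isUnit_smul_one hm.1

theorem isUnit_smul_iff (B : LeadingBasis k A M Γ) {a : A} (ha : a ≠ 0) {c : k} (hc : c ≠ 0) :
    IsUnit (c • a) ↔ IsUnit a := by
  rw [((isLead_lead (B := B) ha).smul hc).isUnit_iff, (isLead_lead (B := B) ha).isUnit_iff]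

theorem key_lead_mul {a b : A} (ha : a ≠ 0) (hb : b ≠ 0) :
    B.key (B.lead (a * b)) = B.key (B.lead a) + B.key (B.lead b) := by
  rw [((isLead_lead ha).mul (isLead_lead hb)).lead_eq, map_add]

theorem key_lead_pos {a : A} (ha : a ≠ 0) (hu : ¬ IsUnit a) : 0 < B.key (B.lead a) := by
  refine lt_of_le_of_ne (B.key_nonneg _) fun h => hu ?_
  rw [(isLead_lead (B := B) ha).isUnit_iff]
  apply B.key_injective
  rw [← h, map_zero]

theorem key_lead_left_lt {a b : A} (ha : a ≠ 0) (hb : b ≠ 0) (hu : ¬ IsUnit b) :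
    B.key (B.lead a) < B.key (B.lead (a * b)) := by
  rw [key_lead_mul ha hb]
  exact lt_add_of_pos_right _ (key_lead_pos hb hu)

theorem key_lead_right_lt {a b : A} (ha : a ≠ 0) (hb : b ≠ 0) (hu : ¬ IsUnit a) :
    B.key (B.lead b) < B.key (B.lead (a * b)) := by
  rw [key_lead_mul ha hb]
  exact lt_add_of_pos_left _ (key_lead_pos ha hu)

/-! ### Existence and finiteness of factorizations. -/

variable (B)

theorem exists_irredFactorization (B : LeadingBasis k A M Γ) [WellFoundedLT Γ] (a : A)
    (ha : a ≠ 0) (hu : ¬ IsUnit a) :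
    ∃ l : List A, IsIrredFactorization a l := by
  have := B.isDomain
  induction h : B.key (B.lead a) using WellFoundedLT.induction generalizing a with
  | ind g ih =>
    subst h
    by_cases hirr : Irreducible a
    · exact ⟨[a], by simpa using hirr, by simp⟩
    · simp only [irreducible_iff, hu, not_false_eq_true, true_and] at hirr
      push Not at hirr
      obtain ⟨b, c, rfl, hb, hc⟩ := hirr
      have hb0 := left_ne_zero_of_mul ha
      have hc0 := right_ne_zero_of_mul ha
      obtain ⟨l, hl, hlp⟩ := ih _ (key_lead_left_lt hb0 hc0 hc) b hb0 hb rfl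
      obtain ⟨l', hl', hlp'⟩ := ih _ (key_lead_right_lt hb0 hc0 hb) c hc0 hc rfl
      refine ⟨l ++ l', fun p hp => ?_, by rw [List.prod_append, hlp, hlp']⟩
      rcases List.mem_append.1 hp with h | h
      exacts [hl p h, hl' p h]

/-- Only finitely many pairs of leading indices sum to that of `a`. Moving the leading coefficient
of `b` onto `d` normalizes `b` and forces the leading coefficient of `d`, so each pair falls under
`finite_normalized_left_factors`. -/
theorem finite_normalize_left_factors {a : A} (ha : a ≠ 0) :
    (B.normalize '' {b : A | ∃ d, b * d = a}).Finite := by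
  have hDf := B.finite_key_le (B.key (B.lead a))
  set D := hDf.toFinset with hD
  have hmemD : ∀ m, m ∈ D ↔ B.key m ≤ B.key (B.lead a) := fun m => by simp [hD]
  have hT : ((D ×ˢ D : Finset (M × M)) : Set (M × M)).Finite := Finset.finite_toSet _
  have hT' := hT.subset (Set.inter_subset_left (t := {p : M × M | p.1 + p.2 = B.lead a}))
  refine (hT'.biUnion (t := fun p => {b : A | (B.basis.repr b).support ⊆ D ∧
      B.basis.repr b p.1 = 1 ∧ ∃ d, (B.basis.repr d).support ⊆ D ∧ B.basis.repr d p.2 =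
        B.basis.repr a (B.lead a) / B.struct p.1 p.2 (p.1 + p.2) ∧ b * d = a}) ?_).subset ?_
  · rintro ⟨m, n⟩ ⟨hmn, -⟩
    simp only [Finset.coe_product, Set.mem_prod, Finset.mem_coe] at hmn
    exact B.finite_normalized_left_factors a hmn.1 hmn.2
      (div_ne_zero (isLead_lead ha).1 (B.repr_add_ne_zero m n))
  · rintro _ ⟨b, ⟨d, rfl⟩, rfl⟩
    have := B.isDomain
    have hb0 := left_ne_zero_of_mul ha
    have hd0 := right_ne_zero_of_mul ha
    set β := B.basis.repr b (B.lead b) with hβ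
    have hβ0 : β ≠ 0 := (isLead_lead hb0).1
    have hb : B.IsLead (B.normalize b) (B.lead b) := (isLead_lead hb0).smul (inv_ne_zero hβ0)
    have hd : B.IsLead (β • d) (B.lead d) := (isLead_lead hd0).smul hβ0
    have hprod : B.normalize b * (β • d) = b * d := by
      rw [mul_smul_comm, ← smul_mul_assoc, smul_normalize hb0]
    have hlead : B.lead b + B.lead d = B.lead (b * d) :=
      ((isLead_lead hb0).mul (isLead_lead hd0)).lead_eq.symm
    have hb1 : B.basis.repr (B.normalize b) (B.lead b) = 1 := by
      rw [normalize, map_smul, Finsupp.smul_apply, smul_eq_mul, inv_mul_cancel₀ hβ0]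
    have hbD : ∀ r, B.key r ≤ B.key (B.lead b) → r ∈ D := fun r hr => by
      rw [hmemD, ← hlead]; exact hr.trans (key_le_add_left _ _)
    have hdD : ∀ r, B.key r ≤ B.key (B.lead d) → r ∈ D := fun r hr => by
      rw [hmemD, ← hlead]; exact hr.trans (key_le_add_right _ _)
    refine Set.mem_biUnion (x := (B.lead b, B.lead d)) ⟨?_, hlead⟩
      ⟨fun r hr => hbD r (hb.2 r (Finsupp.mem_support_iff.1 hr)), hb1, β • d,
        fun r hr => hdD r (hd.2 r (Finsupp.mem_support_iff.1 hr)), ?_, hprod⟩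
    · simpa using ⟨hbD _ le_rfl, hdD _ le_rfl⟩
    · have hs : B.struct (B.lead b) (B.lead d) (B.lead b + B.lead d) ≠ 0 :=
        B.repr_add_ne_zero _ _
      rw [eq_div_iff hs, ← hlead, ← hprod, hb.repr_mul hd, hb1, one_mul]

/-- Allowing arbitrary non-unit factors and a scalar multiple of `a` makes the induction close:
removing the first factor leaves a scalar multiple of a cofactor that depends only on its
normalization. -/
theorem finite_map_normalize_factorizations [WellFoundedLT Γ] {a : A} (ha : a ≠ 0) :
    (List.map B.normalize '' {l : List A | (∀ p ∈ l, ¬ IsUnit p) ∧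
      ∃ c : k, c ≠ 0 ∧ l.prod = c • a}).Finite := by
  have := B.isDomain
  induction h : B.key (B.lead a) using WellFoundedLT.induction generalizing a with
  | ind g ih =>
    subst h
    have hN := B.finite_normalize_left_factors ha
    set N := B.normalize '' {b : A | ∃ d, b * d = a} with hNdef
    have hcof : ∀ b ∈ N, ∃ d, b * d = a := by
      rintro _ ⟨b, ⟨d, rfl⟩, rfl⟩
      refine ⟨B.basis.repr b (B.lead b) • d, ?_⟩
      rw [mul_smul_comm, ← smul_mul_assoc, smul_normalize (left_ne_zero_of_mul ha)]
    choose! d hd using hcof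
    -- Restricting to non-units makes the key of the cofactor drop strictly.
    have hN' := hN.subset (Set.inter_subset_left (t := {b : A | ¬ IsUnit b}))
    refine ((Set.finite_singleton []).union (hN'.biUnion (t := fun b => List.cons b ''
      (List.map B.normalize '' {l : List A | (∀ p ∈ l, ¬ IsUnit p) ∧
        ∃ c : k, c ≠ 0 ∧ l.prod = c • d b})) fun b hb => Set.Finite.image _ ?_)).subset ?_
    · have hbd := hd b hb.1
      have hbd0 : b * d b ≠ 0 := hbd ▸ ha
      refine ih _ ?_ (right_ne_zero_of_mul hbd0) rfl
      conv_rhs => rw [← hbd]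
      exact key_lead_right_lt (left_ne_zero_of_mul hbd0) (right_ne_zero_of_mul hbd0) hb.2
    · rintro _ ⟨l, ⟨hl, c, hc, hprod⟩, rfl⟩
      cases l with
      | nil => exact Or.inl rfl
      | cons p l =>
        right
        rw [List.prod_cons] at hprod
        have h0 : p * l.prod ≠ 0 := by rw [hprod]; exact smul_ne_zero hc ha
        have hp0 := left_ne_zero_of_mul h0
        have hpN : B.normalize p ∈ N := ⟨p, ⟨c⁻¹ • l.prod, by
          rw [mul_smul_comm, hprod, smul_smul, inv_mul_cancel₀ hc, one_smul]⟩, rfl⟩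
        set β := B.basis.repr p (B.lead p)
        have hβ0 : β ≠ 0 := (isLead_lead hp0).1
        have hpu : ¬ IsUnit (B.normalize p) := by
          rw [normalize, B.isUnit_smul_iff hp0 (inv_ne_zero hβ0)]
          exact hl p (by simp)
        refine Set.mem_biUnion (x := B.normalize p) ⟨hpN, hpu⟩ ⟨_, ⟨l, ⟨fun q hq =>
          hl q (by simp [hq]), β⁻¹ * c, mul_ne_zero (inv_ne_zero hβ0) hc, ?_⟩, rfl⟩, rfl⟩
        apply mul_left_cancel₀ hp0
        rw [hprod, mul_smul_comm, mul_comm, mul_smul, ← smul_mul_assoc]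
        change _ = c • (B.normalize p * _)
        rw [hd _ hpN]

theorem isFiniteFactorizationDomain (B : LeadingBasis k A M Γ) [WellFoundedLT Γ] :
    IsFiniteFactorizationDomain A where
  isDomain := B.isDomain
  exists_factorization := B.exists_irredFactorization
  finite_factorizations a ha _ := by
    have := B.isDomain
    have hfin : (List.map B.normalize '' {l | IsIrredFactorization a l}).Finite :=
      (B.finite_map_normalize_factorizations ha).subset (Set.image_mono fun l hl =>
        ⟨fun p hp => (hl.1 p hp).not_isUnit, 1, one_ne_zero, by rw [hl.2, one_smul]⟩)
    -- `S` picks one factorization for each of the finitely many normalized lists.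
    obtain ⟨S, hS, hSf, hSi⟩ := Set.Finite.exists_subset_finite_image_eq hfin subset_rfl
    refine ⟨S, hSf, hS, fun l hl => ?_⟩
    obtain ⟨m, hm, hml⟩ : List.map B.normalize l ∈ List.map B.normalize '' S :=
      hSi ▸ Set.mem_image_of_mem _ hl
    exact ⟨m, hm, B.sameUpToCentralUnits_of_map_normalize_eq (fun p hp => (hl.1 p hp).ne_zero)
      (fun p hp => ((hS hm).1 p hp).ne_zero) hml.symm⟩

end LeadingBasis

/-! ### Ore extensions of a polynomial ring in one variable -/

/-- The degree-lexicographic key of a pair of exponents. -/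
def degLexKey : ℕ × ℕ →+ ℕ ×ₗ ℕ where
  toFun m := toLex (m.1 + m.2, m.2)
  map_zero' := rfl
  map_add' m n := by
    simp only [Prod.fst_add, Prod.snd_add, ← toLex_add, Prod.mk_add_mk]
    congr 2
    ring

theorem degLexKey_injective : Function.Injective degLexKey := by
  intro m n h
  have h' : (m.1 + m.2, m.2) = (n.1 + n.2, n.2) := toLex.injective h
  simp only [Prod.mk.injEq] at h'
  ext <;> omega

theorem degLexKey_lt_iff {m n : ℕ × ℕ} : degLexKey m < degLexKey n ↔
    m.1 + m.2 < n.1 + n.2 ∨ m.1 + m.2 = n.1 + n.2 ∧ m.2 < n.2 :=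
  Prod.Lex.toLex_lt_toLex

theorem add_le_add_of_degLexKey_le {m n : ℕ × ℕ} (h : degLexKey m ≤ degLexKey n) :
    m.1 + m.2 ≤ n.1 + n.2 := by
  rcases Prod.Lex.toLex_le_toLex.1 h with h | h
  exacts [h.le, h.1.le]

theorem finite_setOf_add_le (d : ℕ) : {m : ℕ × ℕ | m.1 + m.2 ≤ d}.Finite :=
  (Set.finite_Iic (d, d)).subset fun m hm => by
    simp only [Set.mem_ofPred_eq] at hm
    exact Prod.mk_le_mk.2 ⟨by omega, by omega⟩

section OreMonomials

variable {k A : Type*} [Field k] [Ring A] [Algebra k A] {z y : A} {a b c₀ c₂ : k}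

/-- The span of the monomials `zⁱ yʲ` of key smaller than that of `m`. -/
def lowerSpan (k : Type*) {A : Type*} [Field k] [Ring A] [Algebra k A] (z y : A) (m : ℕ × ℕ) :
    Submodule k A :=
  Submodule.span k ((fun r : ℕ × ℕ => z ^ r.1 * y ^ r.2) '' {r | degLexKey r < degLexKey m})

theorem monomial_mem_lowerSpan {r m : ℕ × ℕ} (h : degLexKey r < degLexKey m) :
    z ^ r.1 * y ^ r.2 ∈ lowerSpan k z y m :=
  Submodule.subset_span ⟨r, h, rfl⟩

theorem lowerSpan_mono {m n : ℕ × ℕ} (h : degLexKey m ≤ degLexKey n) :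
    lowerSpan k z y m ≤ lowerSpan k z y n :=
  Submodule.span_mono (Set.image_mono fun _ hr => lt_of_lt_of_le hr h)

theorem pow_mul_mem_lowerSpan (i : ℕ) {m : ℕ × ℕ} {u : A} (hu : u ∈ lowerSpan k z y m) :
    z ^ i * u ∈ lowerSpan k z y (i + m.1, m.2) := by
  induction hu using Submodule.span_induction with
  | mem u hu =>
    obtain ⟨r, hr, rfl⟩ := hu
    dsimp only
    rw [← mul_assoc, ← pow_add]
    refine monomial_mem_lowerSpan (r := (i + r.1, r.2)) ?_
    have := degLexKey_lt_iff.1 hr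
    rw [degLexKey_lt_iff]
    dsimp only
    omega
  | zero => simp
  | add u v _ _ hu hv => rw [mul_add]; exact add_mem hu hv
  | smul c u _ hu => rw [mul_smul_comm]; exact Submodule.smul_mem _ c hu

theorem mul_pow_mem_lowerSpan (j : ℕ) {m : ℕ × ℕ} {u : A} (hu : u ∈ lowerSpan k z y m) :
    u * y ^ j ∈ lowerSpan k z y (m.1, m.2 + j) := by
  induction hu using Submodule.span_induction with
  | mem u hu =>
    obtain ⟨r, hr, rfl⟩ := hu
    dsimp only
    rw [mul_assoc, ← pow_add]
    refine monomial_mem_lowerSpan (r := (r.1, r.2 + j)) ?_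
    have := degLexKey_lt_iff.1 hr
    rw [degLexKey_lt_iff]
    dsimp only
    omega
  | zero => simp
  | add u v _ _ hu hv => rw [add_mul]; exact add_mem hu hv
  | smul c u _ hu => rw [smul_mul_assoc]; exact Submodule.smul_mem _ c hu

theorem mul_pow_sub_mem_lowerSpan
    (hrel : y * z = a • (z * y) + b • y + c₀ • 1 + c₂ • z ^ 2) (i : ℕ) :
    y * z ^ i - a ^ i • (z ^ i * y) ∈ lowerSpan k z y (i, 1) := by
  induction i with
  | zero => simp
  | succ i ih =>
    have h1 : y * z ^ (i + 1) - a ^ (i + 1) • (z ^ (i + 1) * y) =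
        a • (z ^ 1 * (y * z ^ i - a ^ i • (z ^ i * y))) +
        b • (y * z ^ i - a ^ i • (z ^ i * y)) + (b * a ^ i) • (z ^ i * y ^ 1) +
        c₀ • (z ^ i * y ^ 0) + c₂ • (z ^ (i + 2) * y ^ 0) := by
      rw [pow_succ' z i, ← mul_assoc y, hrel]
      simp only [add_mul, mul_sub, smul_sub, smul_mul_assoc, mul_smul_comm, smul_smul, mul_assoc,
        pow_one, pow_zero, mul_one, one_mul, pow_succ' a i,
        ← pow_add z 2 i, add_comm i 2]
      abel
    rw [h1]
    refine add_mem (add_mem (add_mem (add_mem ?_ ?_) ?_) ?_) ?_ <;> apply Submodule.smul_mem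
    · have := pow_mul_mem_lowerSpan 1 ih
      rwa [add_comm 1] at this
    · exact lowerSpan_mono (degLexKey_lt_iff.2 (by dsimp only; omega)).le ih
    · exact monomial_mem_lowerSpan (r := (i, 1)) (degLexKey_lt_iff.2 (by dsimp only; omega))
    · exact monomial_mem_lowerSpan (r := (i, 0)) (degLexKey_lt_iff.2 (by dsimp only; omega))
    -- This term has the same total degree as `z ^ (i + 1) * y`; the tie-break on the exponent of
    -- `y` makes it lower.
    · exact monomial_mem_lowerSpan (r := (i + 2, 0)) (degLexKey_lt_iff.2 (by dsimp only; omega))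

theorem mul_mem_lowerSpan
    (hrel : y * z = a • (z * y) + b • y + c₀ • 1 + c₂ • z ^ 2) {m : ℕ × ℕ} {u : A}
    (hu : u ∈ lowerSpan k z y m) : y * u ∈ lowerSpan k z y (m.1, m.2 + 1) := by
  induction hu using Submodule.span_induction with
  | mem u hu =>
    obtain ⟨r, hr, rfl⟩ := hu
    dsimp only
    have h : y * (z ^ r.1 * y ^ r.2) = (y * z ^ r.1 - a ^ r.1 • (z ^ r.1 * y)) * y ^ r.2 +
        a ^ r.1 • (z ^ r.1 * y ^ (r.2 + 1)) := by
      rw [sub_mul, smul_mul_assoc, mul_assoc (z ^ r.1), ← pow_succ', mul_assoc]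
      abel
    have hlt : degLexKey (r.1, r.2 + 1) < degLexKey (m.1, m.2 + 1) := by
      have := degLexKey_lt_iff.1 hr
      rw [degLexKey_lt_iff]
      dsimp only
      omega
    rw [h]
    refine add_mem
      (lowerSpan_mono ?_ (mul_pow_mem_lowerSpan r.2 (mul_pow_sub_mem_lowerSpan hrel r.1)))
      (Submodule.smul_mem _ _ (monomial_mem_lowerSpan (r := (r.1, r.2 + 1)) hlt))
    rw [add_comm 1 r.2]
    exact hlt.le
  | zero => simp
  | add u v _ _ hu hv => rw [mul_add]; exact add_mem hu hv
  | smul c u _ hu => rw [mul_smul_comm]; exact Submodule.smul_mem _ c hu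

/-- Each of the `i * j` exchanges of a `y` with a `z` contributes one factor `a` to the leading
coefficient. -/
theorem pow_mul_pow_sub_mem_lowerSpan
    (hrel : y * z = a • (z * y) + b • y + c₀ • 1 + c₂ • z ^ 2) (i j : ℕ) :
    y ^ j * z ^ i - a ^ (i * j) • (z ^ i * y ^ j) ∈ lowerSpan k z y (i, j) := by
  induction j with
  | zero => simp
  | succ j ih =>
    have h : y ^ (j + 1) * z ^ i - a ^ (i * (j + 1)) • (z ^ i * y ^ (j + 1)) =
        y * (y ^ j * z ^ i - a ^ (i * j) • (z ^ i * y ^ j)) +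
          a ^ (i * j) • ((y * z ^ i - a ^ i • (z ^ i * y)) * y ^ j) := by
      rw [mul_sub, sub_mul, smul_sub, mul_smul_comm, smul_mul_assoc, smul_smul, ← pow_add,
        ← mul_add_one, pow_succ' y j]
      simp only [mul_assoc]
      abel
    have h1 := mul_mem_lowerSpan hrel ih
    have h2 := mul_pow_mem_lowerSpan j (mul_pow_sub_mem_lowerSpan hrel i)
    dsimp only at h1 h2
    rw [add_comm 1] at h2
    rw [h]
    exact add_mem h1 (Submodule.smul_mem _ _ h2)

theorem monomial_mul_monomial_sub_mem_lowerSpan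
    (hrel : y * z = a • (z * y) + b • y + c₀ • 1 + c₂ • z ^ 2) (m n : ℕ × ℕ) :
    z ^ m.1 * y ^ m.2 * (z ^ n.1 * y ^ n.2) -
      a ^ (n.1 * m.2) • (z ^ (m + n).1 * y ^ (m + n).2) ∈ lowerSpan k z y (m + n) := by
  have h : z ^ m.1 * y ^ m.2 * (z ^ n.1 * y ^ n.2) -
      a ^ (n.1 * m.2) • (z ^ (m + n).1 * y ^ (m + n).2) = z ^ m.1 *
        ((y ^ m.2 * z ^ n.1 - a ^ (n.1 * m.2) • (z ^ n.1 * y ^ m.2)) * y ^ n.2) := by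
    rw [sub_mul, mul_sub, smul_mul_assoc, mul_smul_comm, Prod.fst_add, Prod.snd_add, pow_add,
      pow_add]
    simp only [mul_assoc]
  have hmn : m + n = (m.1 + n.1, m.2 + n.2) := rfl
  have h2 := pow_mul_mem_lowerSpan m.1
    (mul_pow_mem_lowerSpan n.2 (pow_mul_pow_sub_mem_lowerSpan hrel n.1 m.2))
  rw [h, hmn]
  exact h2

theorem span_monomial_eq_top
    (hrel : y * z = a • (z * y) + b • y + c₀ • 1 + c₂ • z ^ 2)
    (hgen : Algebra.adjoin k {z, y} = ⊤) :
    Submodule.span k (Set.range fun r : ℕ × ℕ => z ^ r.1 * y ^ r.2) = ⊤ := by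
  set W := Submodule.span k (Set.range fun r : ℕ × ℕ => z ^ r.1 * y ^ r.2) with hW
  have hmem : ∀ r : ℕ × ℕ, z ^ r.1 * y ^ r.2 ∈ W := fun r => Submodule.subset_span ⟨r, rfl⟩
  have hlow : ∀ m, lowerSpan k z y m ≤ W := fun m =>
    Submodule.span_mono (Set.image_subset_range _ _)
  have hmul : W * W ≤ W := by
    rw [hW, Submodule.span_mul_span, Submodule.span_le]
    rintro _ ⟨_, ⟨m, rfl⟩, _, ⟨n, rfl⟩, rfl⟩
    have h := add_mem (hlow _ (monomial_mul_monomial_sub_mem_lowerSpan hrel m n))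
      (W.smul_mem (a ^ (n.1 * m.2)) (hmem (m + n)))
    rwa [sub_add_cancel] at h
  let S : Subalgebra k A := W.toSubalgebra (by simpa using hmem (0, 0))
    fun u v hu hv => hmul (Submodule.mul_mem_mul hu hv)
  have hS : Algebra.adjoin k {z, y} ≤ S := Algebra.adjoin_le (by
    rintro u (rfl | rfl)
    · exact (by simpa using hmem (1, 0) : u ∈ W)
    · exact (by simpa using hmem (0, 1) : u ∈ W))
  rw [hgen] at hS
  exact top_le_iff.1 fun u _ => hS (Algebra.mem_top : u ∈ _)

/-- The monomials `zⁱ yʲ` form a leading basis of an algebra generated by `z` and `y` with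
`y z = (a z + b) y + c₀ + c₂ z²`, provided that they are linearly independent. -/
noncomputable def LeadingBasis.ofOre
    (hrel : y * z = a • (z * y) + b • y + c₀ • 1 + c₂ • z ^ 2)
    (ha : a ≠ 0) (hgen : Algebra.adjoin k {z, y} = ⊤)
    (hli : LinearIndependent k fun r : ℕ × ℕ => z ^ r.1 * y ^ r.2) :
    LeadingBasis k A (ℕ × ℕ) (ℕ ×ₗ ℕ) :=
  let e := Module.Basis.mk hli (span_monomial_eq_top hrel hgen).ge
  have he : ∀ r, e r = z ^ r.1 * y ^ r.2 := Module.Basis.mk_apply _ _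
  have hlow : ∀ m : ℕ × ℕ, ∀ u ∈ lowerSpan k z y m, ∀ r, e.repr u r ≠ 0 →
      degLexKey r < degLexKey m := fun m u hu r => by
    contrapose
    intro hr
    induction hu using Submodule.span_induction with
    | mem u hu =>
      obtain ⟨n, hn, rfl⟩ := hu
      dsimp only
      rw [← he, e.repr_self]
      exact Finsupp.single_eq_of_ne fun h => hr (h ▸ hn)
    | zero => simp
    | add u v _ _ hu hv => simp [hu, hv]
    | smul c u _ hu => simp [hu]
  have hprod : ∀ m n, ∃ u ∈ lowerSpan k z y (m + n), e m * e n =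
      u + a ^ (n.1 * m.2) • e (m + n) := fun m n =>
    ⟨_, monomial_mul_monomial_sub_mem_lowerSpan hrel m n, by simp only [he, sub_add_cancel]⟩
  { basis := e
    key := degLexKey
    key_injective := degLexKey_injective
    key_nonneg := fun m => Prod.Lex.toLex_mono (Prod.mk_le_mk.2 ⟨zero_le, zero_le⟩)
    finite_key_le := fun g => (finite_setOf_add_le (ofLex g).1).subset fun m hm => by
      rcases Prod.Lex.le_iff.1 hm with h | h
      exacts [h.le, h.1.le]
    basis_zero := by simp [he]
    key_le_of_repr_ne_zero := fun m n r h => by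
      obtain ⟨u, hu, hmn⟩ := hprod m n
      rw [hmn] at h
      by_cases hr : r = m + n
      · rw [hr]
      · refine (hlow _ u hu r ?_).le
        simpa [Finsupp.single_eq_of_ne hr] using h
    repr_add_ne_zero := fun m n => by
      obtain ⟨u, hu, hmn⟩ := hprod m n
      have h0 : e.repr u (m + n) = 0 := by
        by_contra h
        exact lt_irrefl _ (hlow _ u hu _ h)
      simp [hmn, h0, ha] }

end OreMonomials

/-! ### The regular representation of an Ore extension -/

section OreRepresentation

variable {k : Type*} [Field k]

/-- Multiplication by `z` on the free module with basis `zⁱ yʲ`. -/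
noncomputable def oreMulZ (k : Type*) [Field k] : (ℕ × ℕ →₀ k) →ₗ[k] (ℕ × ℕ →₀ k) :=
  Finsupp.linearCombination k fun m => Finsupp.single (m.1 + 1, m.2) 1

/-- The product of `y` and `zⁱ yʲ`, expanded in the monomials by `y z = (a z + b) y + c₀ + c₂ z²`. -/
noncomputable def oreMulYMonomial (a b c₀ c₂ : k) : ℕ → ℕ → (ℕ × ℕ →₀ k)
  | 0, j => Finsupp.single (0, j + 1) 1
  | i + 1, j => a • oreMulZ k (oreMulYMonomial a b c₀ c₂ i j) + b • oreMulYMonomial a b c₀ c₂ i j +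
      c₀ • Finsupp.single (i, j) 1 + c₂ • Finsupp.single (i + 2, j) 1

/-- Multiplication by `y` on the free module with basis `zⁱ yʲ`. -/
noncomputable def oreMulY (a b c₀ c₂ : k) : (ℕ × ℕ →₀ k) →ₗ[k] (ℕ × ℕ →₀ k) :=
  Finsupp.linearCombination k fun m => oreMulYMonomial a b c₀ c₂ m.1 m.2

/-- On basis vectors this is the recursion defining `oreMulYMonomial`, so no rewriting or confluence
argument is needed. -/
theorem oreMulY_mul_oreMulZ (a b c₀ c₂ : k) :
    (oreMulY a b c₀ c₂ * oreMulZ k : Module.End k (ℕ × ℕ →₀ k)) =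
      a • (oreMulZ k * oreMulY a b c₀ c₂) + b • oreMulY a b c₀ c₂ + c₀ • 1 +
        c₂ • oreMulZ k ^ 2 := by
  refine Finsupp.lhom_ext' fun m => LinearMap.ext_ring ?_
  simp [oreMulY, oreMulZ, oreMulYMonomial, pow_two]

theorem oreMulZ_pow_mul_oreMulY_pow_apply (a b c₀ c₂ : k) (i j : ℕ) :
    (oreMulZ k ^ i * oreMulY a b c₀ c₂ ^ j : Module.End k (ℕ × ℕ →₀ k)) (Finsupp.single 0 1) =
      Finsupp.single (i, j) 1 := by
  induction i with
  | zero =>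
    rw [pow_zero, one_mul]
    induction j with
    | zero => rfl
    | succ j ih =>
      rw [pow_succ', Module.End.mul_apply, ih]
      simp [oreMulY, oreMulYMonomial]
  | succ i ih =>
    rw [pow_succ', mul_assoc, Module.End.mul_apply, ih]
    simp [oreMulZ]

/-- Acting on the vector of index `0`, the monomials give distinct basis vectors, so no relation
between them is possible. -/
theorem linearIndependent_monomial_of_algHom {A : Type*} [Ring A] [Algebra k A] {z y : A}
    {a b c₀ c₂ : k} (φ : A →ₐ[k] Module.End k (ℕ × ℕ →₀ k)) (hz : φ z = oreMulZ k)
    (hy : φ y = oreMulY a b c₀ c₂) :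
    LinearIndependent k fun r : ℕ × ℕ => z ^ r.1 * y ^ r.2 := by
  refine LinearIndependent.of_comp
    ((LinearMap.applyₗ (Finsupp.single (0 : ℕ × ℕ) (1 : k))).comp φ.toLinearMap) ?_
  convert (Finsupp.basisSingleOne (R := k) (ι := ℕ × ℕ)).linearIndependent using 1
  funext r
  simp only [Function.comp_apply, LinearMap.comp_apply, AlgHom.toLinearMap_apply, map_mul, map_pow,
    hz, hy, LinearMap.applyₗ_apply_apply, oreMulZ_pow_mul_oreMulY_pow_apply,
    Finsupp.coe_basisSingleOne]

end OreRepresentation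

/-! ### Finite tensor products -/

/-- The total weight followed by the tuple of the keys, compared lexicographically. -/
def piLexKey {ι M Γ : Type*} [Fintype ι] [AddCommMonoid M] [AddCommMonoid Γ] (w : M →+ ℕ)
    (κ : M →+ Γ) : (ι → M) →+ ℕ ×ₗ Lex (ι → Γ) where
  toFun m := toLex (∑ i, w (m i), toLex fun i => κ (m i))
  map_zero' := by simp; rfl
  map_add' m n := by
    simp only [Pi.add_apply, map_add, Finset.sum_add_distrib]
    rfl

/-- The tensor products of the elements of leading bases form a leading basis, if the keys
refine a weight with finite sublevel sets. -/
noncomputable def LeadingBasis.piTensorProduct {k ι M Γ : Type*} {A : ι → Type*} [Field k]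
    [Fintype ι] [LinearOrder ι] [∀ i, Ring (A i)] [∀ i, Algebra k (A i)] [AddCommMonoid M]
    [AddCommMonoid Γ] [LinearOrder Γ] (w : M →+ ℕ) (κ : M →+ Γ)
    (hw : ∀ d, {m | w m ≤ d}.Finite) (hκ : ∀ m n, κ m ≤ κ n → w m ≤ w n)
    (B : ∀ i, LeadingBasis k (A i) M Γ) (hB : ∀ i, (B i).key = κ) :
    LeadingBasis k (⨂[k] i, A i) (ι → M) (ℕ ×ₗ Lex (ι → Γ)) :=
  have hmul : ∀ m n r : ι → M, (Basis.piTensorProduct fun i => (B i).basis).repr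
      (Basis.piTensorProduct (fun i => (B i).basis) m *
        Basis.piTensorProduct (fun i => (B i).basis) n) r =
      ∏ i, (B i).basis.repr ((B i).basis (m i) * (B i).basis (n i)) (r i) := fun m n r => by
    rw [Basis.piTensorProduct_apply, Basis.piTensorProduct_apply,
      PiTensorProduct.tprod_mul_tprod, Basis.piTensorProduct_repr_tprod_apply]
    rfl
  { basis := Basis.piTensorProduct fun i => (B i).basis
    key := piLexKey w κ
    key_injective := fun m n h => by
      have h1 : (fun i => κ (m i)) = fun i => κ (n i) := by
        have := congrArg (fun p => ofLex (ofLex p).2) h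
        exact this
      funext i
      apply (B i).key_injective
      rw [hB]
      exact congrFun h1 i
    key_nonneg := fun m => Prod.Lex.toLex_mono (Prod.mk_le_mk.2 ⟨zero_le,
      Pi.toLex_monotone fun i => by simpa [hB] using (B i).key_nonneg (m i)⟩)
    finite_key_le := fun g => by
      -- The total weight comes first in the key because the lexicographic order alone can have
      -- infinite sublevel sets.
      refine (Set.Finite.pi' fun _ : ι => hw (ofLex g).1).subset fun m hm i => ?_
      have h : ∑ i, w (m i) ≤ (ofLex g).1 := by
        rcases Prod.Lex.le_iff.1 hm with h | h
        exacts [h.le, h.1.le]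
      exact (Finset.single_le_sum (f := fun i => w (m i)) (fun _ _ => zero_le)
        (Finset.mem_univ i)).trans h
    basis_zero := by
      rw [Basis.piTensorProduct_apply, PiTensorProduct.one_def]
      congr 1
      funext i
      exact (B i).basis_zero
    key_le_of_repr_ne_zero := fun m n r h => by
      rw [hmul, Finset.prod_ne_zero_iff] at h
      have hle : ∀ i, κ (r i) ≤ κ ((m + n) i) := fun i => by
        simpa [hB] using (B i).key_le_of_repr_ne_zero _ _ _ (h i (Finset.mem_univ i))
      exact Prod.Lex.toLex_mono (Prod.mk_le_mk.2
        ⟨Finset.sum_le_sum fun i _ => hκ _ _ (hle i), Pi.toLex_monotone hle⟩)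
    repr_add_ne_zero := fun m n => by
      rw [hmul, Finset.prod_ne_zero_iff]
      exact fun i _ => (B i).repr_add_ne_zero (m i) (n i) }

/-! ### The operator algebras -/

namespace OpAlg

variable {k : Type*} [Field k]

theorem gen_o_mul_gen_x (t : OpType k) : gen t .o * gen t .x =
    RingQuot.mkAlgHom k t.Rel (t.relRHS (FreeAlgebra.ι k .x) (FreeAlgebra.ι k .o)) := by
  rw [gen, gen, ← map_mul]
  exact RingQuot.mkAlgHom_rel k ⟨rfl, rfl⟩

theorem exists_algHom (t : OpType k) {B : Type*} [Ring B] [Algebra k B] (g : OpGen → B)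
    (h : g .o * g .x = FreeAlgebra.lift k g
      (t.relRHS (FreeAlgebra.ι k .x) (FreeAlgebra.ι k .o))) :
    ∃ φ : OpAlg t →ₐ[k] B, ∀ s, φ (gen t s) = g s := by
  refine ⟨RingQuot.liftAlgHom k ⟨FreeAlgebra.lift k g, ?_⟩, fun s => ?_⟩
  · rintro _ _ ⟨rfl, rfl⟩
    rw [map_mul, FreeAlgebra.lift_ι_apply, FreeAlgebra.lift_ι_apply, h]
  · rw [gen, RingQuot.liftAlgHom_mkAlgHom_apply, FreeAlgebra.lift_ι_apply]

theorem adjoin_gen (t : OpType k) : Algebra.adjoin k {gen t .x, gen t .o} = ⊤ := by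
  have h : ({gen t .x, gen t .o} : Set (OpAlg t)) =
      RingQuot.mkAlgHom k t.Rel '' Set.range (FreeAlgebra.ι k) := by
    ext u
    constructor
    · rintro (rfl | rfl)
      exacts [⟨_, ⟨_, rfl⟩, rfl⟩, ⟨_, ⟨_, rfl⟩, rfl⟩]
    · rintro ⟨_, ⟨s, rfl⟩, rfl⟩
      cases s
      exacts [Or.inl rfl, Or.inr rfl]
  rw [h, ← AlgHom.map_adjoin, FreeAlgebra.adjoin_range_ι, Algebra.map_top]
  exact (AlgHom.range_eq_top _).2 (RingQuot.mkAlgHom_surjective k _)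

/-- A leading basis with the degree-lexicographic key from a presentation of the operator algebra
as an Ore extension with the polynomial generator `z` and the Ore variable `y`. -/
theorem exists_leadingBasis_of_ore (t : OpType k) (z y : OpGen)
    (hzy : ({z, y} : Set OpGen) = {.x, .o})
    {a b c₀ c₂ : k} (ha : a ≠ 0)
    (hrel : gen t y * gen t z =
      a • (gen t z * gen t y) + b • gen t y + c₀ • 1 + c₂ • gen t z ^ 2)
    (φ : OpAlg t →ₐ[k] Module.End k (ℕ × ℕ →₀ k)) (hz : φ (gen t z) = oreMulZ k)
    (hy : φ (gen t y) = oreMulY a b c₀ c₂) :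
    ∃ B : LeadingBasis k (OpAlg t) (ℕ × ℕ) (ℕ ×ₗ ℕ), B.key = degLexKey := by
  refine ⟨.ofOre hrel ha ?_ (linearIndependent_monomial_of_algHom φ hz hy), rfl⟩
  rw [← adjoin_gen t, ← Set.image_pair, ← Set.image_pair, hzy]

theorem exists_leadingBasis (t : OpType k) :
    ∃ B : LeadingBasis k (OpAlg t) (ℕ × ℕ) (ℕ ×ₗ ℕ), B.key = degLexKey := by
  have hrel := gen_o_mul_gen_x t
  -- The four types other than integration take `z = x`, `y = o` and `c₂ = 0`.
  have key : ∀ a b c₀ : k, a ≠ 0 → t.relRHS (FreeAlgebra.ι k .x) (FreeAlgebra.ι k .o) =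
      a • (FreeAlgebra.ι k .x * FreeAlgebra.ι k .o) + b • FreeAlgebra.ι k .o + c₀ • 1 →
      ∃ B : LeadingBasis k (OpAlg t) (ℕ × ℕ) (ℕ ×ₗ ℕ), B.key = degLexKey := by
    intro a b c₀ ha hf
    let g : OpGen → Module.End k (ℕ × ℕ →₀ k) := fun
      | .x => oreMulZ k
      | .o => oreMulY a b c₀ 0
    obtain ⟨φ, hφ⟩ := exists_algHom t g (by
      rw [hf]
      simpa [g] using oreMulY_mul_oreMulZ a b c₀ 0)
    refine exists_leadingBasis_of_ore t .x .o rfl (c₂ := 0) ha ?_ φ (hφ .x) (hφ .o)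
    rw [hrel, hf, zero_smul, add_zero]
    simp only [map_add, map_smul, map_mul, map_one]
    rfl
  cases t with
  | differential => exact key 1 0 1 one_ne_zero (by simp [OpType.relRHS])
  | shift => exact key 1 1 0 one_ne_zero (by simp [OpType.relRHS])
  | qShift q => exact key q 0 0 q.ne_zero (by simp [OpType.relRHS])
  | qDifferential q => exact key q 0 1 q.ne_zero (by simp [OpType.relRHS])
  | integration =>
    -- The relation reads `x o = o x + o²`, so here `o` is the polynomial generator and `x` the Ore
    -- variable.
    let g : OpGen → Module.End k (ℕ × ℕ →₀ k) := fun
      | .o => oreMulZ k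
      | .x => oreMulY 1 0 0 1
    obtain ⟨φ, hφ⟩ := exists_algHom (OpType.integration : OpType k) g (by
      have := oreMulY_mul_oreMulZ (1 : k) 0 0 1
      simp only [one_smul, zero_smul, add_zero] at this
      simp only [OpType.relRHS, map_sub, map_mul, map_pow, FreeAlgebra.lift_ι_apply, g]
      exact eq_sub_of_add_eq this.symm)
    refine exists_leadingBasis_of_ore .integration .o .x (Set.pair_comm _ _) (a := 1) (b := 0)
      (c₀ := 0) (c₂ := 1) one_ne_zero ?_ φ (hφ .o) (hφ .x)
    simp only [OpType.relRHS, map_sub, map_mul, map_pow] at hrel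
    change gen .integration .o * gen .integration .x = gen .integration .x * gen .integration .o -
      gen .integration .o ^ 2 at hrel
    simp [hrel]

end OpAlg

/-! ### The action on polynomials. -/

theorem qDerivative_X_mul {k : Type*} [Field k] {q : k} (hq : q ≠ 1) (f : k[X]) :
    qDerivative q (X * f) = C q * (X * qDerivative q f) + f := by
  have h1 : (C (q - 1) * X : k[X]) ≠ 0 :=
    mul_ne_zero (C_ne_zero.2 (sub_ne_zero.2 hq)) X_ne_zero
  apply mul_left_cancel₀ h1
  have h2 := qDerivative_spec q hq f
  rw [qDerivative_spec q hq, mul_add, mul_left_comm, mul_left_comm _ X, h2]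
  simp only [mul_comp, X_comp, C_sub, C_1]
  ring

/-- Integration by parts: both sides have the same derivative and vanish at `0`, which suffices in
characteristic zero. -/
theorem integralFromZero_X_mul {k : Type*} [Field k] [CharZero k] (f : k[X]) :
    integralFromZero k (X * f) =
      X * integralFromZero k f - integralFromZero k (integralFromZero k f) := by
  have h1 := integralFromZero_spec f
  have h2 := integralFromZero_spec (X * f)
  have h3 := integralFromZero_spec (integralFromZero k f)
  rw [← sub_eq_zero]
  have hd : derivative (integralFromZero k (X * f) -
      (X * integralFromZero k f - integralFromZero k (integralFromZero k f))) = 0 := by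
    simp [h1.1, h2.1, h3.1]
  rw [eq_C_of_derivative_eq_zero hd, coeff_zero_eq_eval_zero]
  simp [h2.2, h3.2]

theorem OpAlg.exists_action {k : Type*} [Field k] (t : OpType k) (ht : t.IsMeaningful) :
    ∃ φ : OpAlg t →ₐ[k] Module.End k k[X],
      φ (OpAlg.gen t OpGen.x) = LinearMap.mulLeft k (X : k[X]) ∧
      φ (OpAlg.gen t OpGen.o) = t.operator := by
  let g : OpGen → Module.End k k[X] := fun
    | .x => LinearMap.mulLeft k (X : k[X])
    | .o => t.operator
  suffices h : g .o * g .x = FreeAlgebra.lift k g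
      (t.relRHS (FreeAlgebra.ι k .x) (FreeAlgebra.ι k .o)) by
    obtain ⟨φ, hφ⟩ := OpAlg.exists_algHom t g h
    exact ⟨φ, hφ .x, hφ .o⟩
  refine LinearMap.ext fun f => ?_
  cases t with
  | differential =>
    simp [OpType.relRHS, g, OpType.operator]
    ring
  | shift =>
    simp [OpType.relRHS, g, OpType.operator]
    ring
  | qShift q =>
    simp [OpType.relRHS, g, OpType.operator, smul_eq_C_mul]
    ring
  | qDifferential q =>
    simpa [OpType.relRHS, g, OpType.operator, smul_eq_C_mul] using qDerivative_X_mul ht f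
  | integration =>
    have : CharZero k := ht
    simpa [OpType.relRHS, g, OpType.operator, pow_two] using integralFromZero_X_mul f

theorem mainTheorem11 (k : Type*) [Field k] :
    (∀ t : OpType k, t.IsMeaningful →
      ∃ φ : OpAlg t →ₐ[k] Module.End k k[X],
        φ (OpAlg.gen t OpGen.x) = LinearMap.mulLeft k (X : k[X]) ∧
        φ (OpAlg.gen t OpGen.o) = t.operator) ∧
    (∀ t : OpType k, IsFiniteFactorizationDomain (OpAlg t)) ∧
    (∀ (n : ℕ) (t : Fin n → OpType k),
      IsFiniteFactorizationDomain (⨂[k] i, OpAlg (t i))) := by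
  refine ⟨OpAlg.exists_action, fun t => ?_, fun n t => ?_⟩
  · exact (OpAlg.exists_leadingBasis t).choose.isFiniteFactorizationDomain
  · choose B hB using fun i => OpAlg.exists_leadingBasis (t i)
    exact (LeadingBasis.piTensorProduct (AddMonoidHom.fst ℕ ℕ + AddMonoidHom.snd ℕ ℕ) degLexKey
      finite_setOf_add_le (fun _ _ => add_le_add_of_degLexKey_le)
      B hB).isFiniteFactorizationDomain
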